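/- Let $K$ be a compact Hausdorff group with Haar probability measure $m_K$, let $\mu$ be a regular Borel probability measure on $K$, and let $(\mathcal V,\theta)$ be a strongly continuous unitary representation of $K$ on a complex Hilbert space. Write $P_\theta$ for the orthogonal projection of $\mathcal V$ onto the subspace of $\theta(K)$-fixed vectors, and for any strongly continuous unitary representation $\sigma$ of $K$ write $\sigma(\mu)w=\int_K\sigma(k)w\,d\mu(k)$. Let $\widehat K$ be the set of unitary equivalence classes of strongly continuous irreducible unitary representations of $K$, and let $[\mathrm{id}]\in\widehat K$ be the class of the trivial one-dimensional representation. For $[\sigma]\in\widehat K$, $k\in K$ and $S\subset\widehat K$ put $$|k|_\sigma=\sup\{\|\sigma(k)w-w\| : \|w\|=1\},\qquad |k|_S=\sup\{|k|_\sigma : [\sigma]\in S\}\quad(\text{with } |k|_\emptyset=0).$$ Let $d_K=\min\{\dim\sigma : [\sigma]\in\widehat K\setminus\{[\mathrm{id}]\}\}$, with $d_K=\infty$ if there is no non-trivial $[\sigma]$. Fix $\delta>0$ and set $$S_\delta=\{[\sigma]\in\widehat K\setminus\{[\mathrm{id}]\} : \|\sigma(\mu)\|_{\mathrm{op}}>\delta\}.$$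 Then for every $v\in\mathcal V$ there exists $k_o\in\operatorname{supp}\mu$ such that, for all $k\in K$, $$\operatorname{Re}\langle\theta(\mu)v,\theta(k_ok)v\rangle\ \ge\ \|P_\theta v\|^2-(2\delta+|k|_{S_\delta})\|v\|^2 .$$ Furthermore, if $\mu\ll m_K$ and $\big\|\tfrac{d\mu}{dm_K}\big\|_{L^2(m_K)}\le\xi$ for a real number $\xi$, then $$|S_\delta|\ \le\ \frac{\xi^2-1}{d_K\,\delta^2},$$ where the right-hand side is $0$ if $d_K=\infty$; in particular $S_\delta$ is finite. -/

import Mathlib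

open MeasureTheory

universe u v w

noncomputable section

/-- A strongly continuous unitary representation of the topological group `K` on `V`. -/
structure UnitaryRep (K : Type u) [Group K] [TopologicalSpace K]
    (V : Type v) [NormedAddCommGroup V] [InnerProductSpace ℂ V] where
  toHom : K →* (V ≃ₗᵢ[ℂ] V)
  strongly_continuous : ∀ x : V, Continuous fun k : K => toHom k x

namespace UnitaryRep

section Basic

variable {K : Type u} [Group K] [TopologicalSpace K]
variable {V : Type v} [NormedAddCommGroup V] [InnerProductSpace ℂ V]
variable {V' : Type w} [NormedAddCommGroup V'] [InnerProductSpace ℂ V']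

instance : CoeFun (UnitaryRep K V) (fun _ => K → V ≃ₗᵢ[ℂ] V) := ⟨fun θ => θ.toHom⟩

/-- The subspace of vectors fixed by all `θ(k)`. -/
def fixed (θ : UnitaryRep K V) : Submodule ℂ V where
  carrier := {x | ∀ k, θ k x = x}
  add_mem' := fun ha hb k => by rw [map_add, ha k, hb k]
  zero_mem' := fun k => map_zero _
  smul_mem' := fun c x hx k => by rw [map_smul, hx k]

theorem isClosed_fixed (θ : UnitaryRep K V) : IsClosed (θ.fixed : Set V) := by
  have h : (θ.fixed : Set V) = ⋂ k, {x | θ k x = x} := by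
    ext x; simp [fixed]
  rw [h]
  exact isClosed_iInter fun k => isClosed_eq (θ k).continuous continuous_id

instance [CompleteSpace V] (θ : UnitaryRep K V) : CompleteSpace θ.fixed :=
  θ.isClosed_fixed.completeSpace_coe

/-- The orthogonal projection `P_θ` onto the subspace of fixed vectors, as an operator on `V`. -/
def fixedProj [CompleteSpace V] (θ : UnitaryRep K V) : V →L[ℂ] V := θ.fixed.starProjection

/-- Irreducibility: the space is non-zero, and the only closed invariant subspaces are `0` and
the whole space. -/
def IsIrreducible (θ : UnitaryRep K V) : Prop :=
  Nontrivial V ∧ ∀ U : Submodule ℂ V, IsClosed (U : Set V) →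
    (∀ k, ∀ x ∈ U, θ k x ∈ U) → U = ⊥ ∨ U = ⊤

/-- Unitary equivalence of representations. -/
def Equivalent (θ : UnitaryRep K V) (θ' : UnitaryRep K V') : Prop :=
  ∃ T : V ≃ₗᵢ[ℂ] V', ∀ k x, T (θ k x) = θ' k (T x)

/-- `|k|_θ`, the supremum of `‖θ(k)x - x‖` over unit vectors `x`. -/
def seminorm (θ : UnitaryRep K V) (k : K) : ℝ :=
  sSup {r : ℝ | ∃ x : V, ‖x‖ = 1 ∧ r = ‖θ k x - x‖}

theorem Equivalent.seminorm_le_aux {θ : UnitaryRep K V} {θ' : UnitaryRep K V'}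
    (h : θ.Equivalent θ') (k : K) :
    {r : ℝ | ∃ x : V, ‖x‖ = 1 ∧ r = ‖θ k x - x‖} ⊆
      {r : ℝ | ∃ x : V', ‖x‖ = 1 ∧ r = ‖θ' k x - x‖} := by
  obtain ⟨T, hT⟩ := h
  rintro r ⟨x, hx, rfl⟩
  exact ⟨T x, by rw [T.norm_map, hx], by rw [← hT, ← map_sub, T.norm_map]⟩

theorem Equivalent.refl (θ : UnitaryRep K V) : θ.Equivalent θ :=
  ⟨LinearIsometryEquiv.refl ℂ V, fun _ _ => rfl⟩

theorem Equivalent.symm {θ : UnitaryRep K V} {θ' : UnitaryRep K V'}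
    (h : θ.Equivalent θ') : θ'.Equivalent θ := by
  obtain ⟨T, hT⟩ := h
  exact ⟨T.symm, fun k x => by rw [LinearIsometryEquiv.symm_apply_eq, hT, T.apply_symm_apply]⟩

theorem Equivalent.trans {V'' : Type w} [NormedAddCommGroup V''] [InnerProductSpace ℂ V'']
    {θ : UnitaryRep K V} {θ' : UnitaryRep K V'} {θ'' : UnitaryRep K V''}
    (h : θ.Equivalent θ') (h' : θ'.Equivalent θ'') : θ.Equivalent θ'' := by
  obtain ⟨T, hT⟩ := h
  obtain ⟨T', hT'⟩ := h'
  exact ⟨T.trans T', fun k x => by simp [hT, hT']⟩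

theorem Equivalent.seminorm_eq {θ : UnitaryRep K V} {θ' : UnitaryRep K V'}
    (h : θ.Equivalent θ') (k : K) : θ.seminorm k = θ'.seminorm k :=
  congrArg sSup ((h.seminorm_le_aux k).antisymm (h.symm.seminorm_le_aux k))

end Basic

section Average

variable {K : Type u} [Group K] [TopologicalSpace K] [CompactSpace K]
variable [MeasurableSpace K] [BorelSpace K]
variable {V : Type v} [NormedAddCommGroup V] [InnerProductSpace ℂ V]
variable {V' : Type w} [NormedAddCommGroup V'] [InnerProductSpace ℂ V']

theorem integrable (θ : UnitaryRep K V) (μ : Measure K) [IsProbabilityMeasure μ] (x : V) :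
    Integrable (fun k => θ k x) μ :=
  (θ.strongly_continuous x).integrable_of_hasCompactSupport
    (HasCompactSupport.of_compactSpace _)

/-- The operator `θ(μ)`, given by `θ(μ)x = ∫ θ(k)x dμ(k)`. -/
def avg (θ : UnitaryRep K V) (μ : Measure K) [IsProbabilityMeasure μ] : V →L[ℂ] V :=
  LinearMap.mkContinuous
    { toFun := fun x => ∫ k, θ k x ∂μ
      map_add' := fun x y => by
        simp only [map_add]
        exact integral_add (θ.integrable μ x) (θ.integrable μ y)
      map_smul' := fun c x => by
        simp only [map_smul, RingHom.id_apply]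
        exact integral_smul c _ }
    1 (fun x => by
      refine (norm_integral_le_of_norm_le_const (C := ‖x‖)
        (Filter.Eventually.of_forall fun k => ?_)).trans ?_
      · rw [LinearIsometryEquiv.norm_map]
      · simp)

theorem avg_apply (θ : UnitaryRep K V) (μ : Measure K) [IsProbabilityMeasure μ] (x : V) :
    θ.avg μ x = ∫ k, θ k x ∂μ := rfl

theorem Equivalent.norm_avg_le {θ : UnitaryRep K V} {θ' : UnitaryRep K V'}
    (h : θ.Equivalent θ') (μ : Measure K) [IsProbabilityMeasure μ] :
    ‖θ.avg μ‖ ≤ ‖θ'.avg μ‖ := by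
  obtain ⟨T, hT⟩ := h
  refine ContinuousLinearMap.opNorm_le_bound _ (norm_nonneg _) fun x => ?_
  have h1 : T (θ.avg μ x) = θ'.avg μ (T x) := by
    rw [avg_apply, avg_apply]
    simp only [← hT]
    exact (T.toContinuousLinearEquiv.integral_comp_comm _).symm
  rw [← T.norm_map, h1, ← T.norm_map x]
  exact ContinuousLinearMap.le_opNorm _ _

end Average

end UnitaryRep

/-- A strongly continuous irreducible unitary representation of `K` on some complex Hilbert
space (of any dimension). -/
structure UnitaryIrrep (K : Type u) [Group K] [TopologicalSpace K] where
  space : Type w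
  [normed : NormedAddCommGroup space]
  [innerProduct : InnerProductSpace ℂ space]
  [complete : CompleteSpace space]
  rep : UnitaryRep K space
  irreducible : rep.IsIrreducible

attribute [instance] UnitaryIrrep.normed UnitaryIrrep.innerProduct UnitaryIrrep.complete

/-- Unitary equivalence as an equivalence relation on irreducible representations. -/
instance UnitaryIrrep.setoid (K : Type u) [Group K] [TopologicalSpace K] :
    Setoid (UnitaryIrrep.{u, w} K) where
  r σ τ := σ.rep.Equivalent τ.rep
  iseqv :=
    { refl := fun σ => UnitaryRep.Equivalent.refl σ.rep
      symm := fun h => h.symm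
      trans := fun h h' => h.trans h' }

/-- The trivial one-dimensional representation of `K`. -/
def UnitaryIrrep.trivial (K : Type u) [Group K] [TopologicalSpace K] : UnitaryIrrep.{u, w} K where
  space := EuclideanSpace ℂ PUnit.{w + 1}
  rep :=
    { toHom := 1
      strongly_continuous := fun _ => continuous_const }
  irreducible := by
    refine ⟨inferInstance, fun U _ _ => ?_⟩
    have h1 : IsSimpleOrder (Submodule ℂ (EuclideanSpace ℂ PUnit.{w + 1})) :=
      isSimpleModule_iff_finrank_eq_one.mpr (by simp) |>.toIsSimpleOrder
    exact eq_bot_or_eq_top U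

/-- The unitary dual of `K`: the unitary equivalence classes of strongly continuous irreducible
unitary representations of `K`. -/
def UnitaryDual (K : Type u) [Group K] [TopologicalSpace K] :=
  Quotient (UnitaryIrrep.setoid.{u, w} K)

namespace UnitaryDual

section Basic

variable {K : Type u} [Group K] [TopologicalSpace K]

/-- The class of the trivial one-dimensional representation. -/
def triv (K : Type u) [Group K] [TopologicalSpace K] : UnitaryDual.{u, w} K :=
  Quotient.mk _ (UnitaryIrrep.trivial K)

/-- The dimension of a class, `⊤` if it is infinite. -/
def dim (c : UnitaryDual.{u, w} K) : ℕ∞ :=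
  Quotient.lift (fun σ : UnitaryIrrep.{u, w} K => Cardinal.toENat (Module.rank ℂ σ.space))
    (fun _ _ h => by
      obtain ⟨T, _⟩ := h
      exact congrArg Cardinal.toENat T.toLinearEquiv.rank_eq) c

/-- `|k|_σ` for the class of `σ`. -/
def seminorm (c : UnitaryDual.{u, w} K) (k : K) : ℝ :=
  Quotient.lift (fun σ : UnitaryIrrep.{u, w} K => σ.rep.seminorm k)
    (fun _ _ h => UnitaryRep.Equivalent.seminorm_eq h k) c

/-- `|k|_S`, the supremum of `|k|_σ` over the classes in `S` (each is at most `2`), which is `0`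
for empty `S`. -/
def seminormOn (S : Set (UnitaryDual.{u, w} K)) (k : K) : ℝ :=
  sSup {r : ℝ | ∃ c ∈ S, r = c.seminorm k}

/-- `d_K`, the smallest dimension of a non-trivial irreducible representation, `⊤` if there is
none. -/
def minDim (K : Type u) [Group K] [TopologicalSpace K] : ℕ∞ :=
  ⨅ c : {c : UnitaryDual.{u, w} K // c ≠ triv K}, c.1.dim

end Basic

section Measure

variable {K : Type u} [Group K] [TopologicalSpace K] [CompactSpace K]
variable [MeasurableSpace K] [BorelSpace K]

/-- The operator norm `‖σ(μ)‖` for the class of `σ`. -/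
def normAvg (c : UnitaryDual.{u, w} K) (μ : Measure K) [IsProbabilityMeasure μ] : ℝ :=
  Quotient.lift (fun σ : UnitaryIrrep.{u, w} K => ‖σ.rep.avg μ‖)
    (fun _ _ h => (UnitaryRep.Equivalent.norm_avg_le h μ).antisymm
      (UnitaryRep.Equivalent.norm_avg_le (UnitaryRep.Equivalent.symm h) μ)) c

/-- `S_δ`, the set of non-trivial classes `[σ]` with `‖σ(μ)‖ > δ`. -/
def large (μ : Measure K) [IsProbabilityMeasure μ] (δ : ℝ) : Set (UnitaryDual.{u, w} K) :=
  {c | c ≠ triv K ∧ δ < c.normAvg μ}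

end Measure

end UnitaryDual

/-- The (regular) Haar probability measure of the compact group `K`. -/
def haarProb (K : Type u) [Group K] [TopologicalSpace K] [IsTopologicalGroup K] [CompactSpace K]
    [MeasurableSpace K] [BorelSpace K] : Measure K :=
  Measure.haarMeasure (⊤ : TopologicalSpace.PositiveCompacts K)

end

/-! The lower bound. By Peter–Weyl the space is the closed orthogonal sum of the fixed vectors, a
part `E₁` built from irreducibles with class in `S_δ`, and a part `E₂` built from the other
non-trivial ones (`exists_spectral_splitting`). All three are invariant, so no cross terms survive.
The fixed part contributes exactly `‖P_θ v‖²`, and the `E₂` part at least `-δ‖v₂‖²`. On `E₁` the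
average over `k₀` of `Re⟪θ(μ)v₁, θ(k₀)v₁⟫` is `‖θ(μ)v₁‖² ≥ 0`, so some `k₀` in the support makes it
non-negative; passing from `k₀` to `k₀k` costs at most `|k|_{S_δ}‖v₁‖²`. This already gives the
bound with `δ` in place of `2δ`.

The cardinality bound. Matrix coefficients of inequivalent irreducibles, scaled by the square root
of the dimension, are orthonormal in `L²(m_K)`. For suitable unit vectors, pairing one with the
density of `μ` gives `√dim σ · ‖σ(μ)x‖`, so Bessel bounds the sum of `dim σ · ‖σ(μ)x‖²` by `ξ²`
(`sum_finrank_mul_norm_avg_sq_le`). The trivial class uses up `1`, and each class in `S_δ` at least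
`d_K δ²`.

Both Peter–Weyl and Schur orthogonality come from one construction, `avgRankOne`: averaging a rank
one operator over Haar measure produces a compact intertwiner. -/

noncomputable section

namespace UnitaryRep

/-! ### Subrepresentations, equivalence and Schur's lemma -/

section Subrepresentation

variable {K : Type u} [Group K] [TopologicalSpace K]
variable {V : Type v} [NormedAddCommGroup V] [InnerProductSpace ℂ V]
variable {V' : Type w} [NormedAddCommGroup V'] [InnerProductSpace ℂ V']

theorem mul_apply (θ : UnitaryRep K V) (k l : K) (x : V) : θ (k * l) x = θ k (θ l x) := by
  rw [map_mul]; rfl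

theorem one_apply (θ : UnitaryRep K V) (x : V) : θ 1 x = x := by
  rw [map_one]; rfl

theorem inv_apply_self (θ : UnitaryRep K V) (k : K) (x : V) : θ k⁻¹ (θ k x) = x := by
  rw [← mul_apply, inv_mul_cancel, one_apply]

theorem apply_inv_self (θ : UnitaryRep K V) (k : K) (x : V) : θ k (θ k⁻¹ x) = x := by
  rw [← mul_apply, mul_inv_cancel, one_apply]

theorem inner_apply_left (θ : UnitaryRep K V) (k : K) (x y : V) :
    inner ℂ (θ k x) y = inner ℂ x (θ k⁻¹ y) := by
  rw [← (θ k).inner_map_map x, apply_inv_self]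

theorem inner_apply_right (θ : UnitaryRep K V) (k : K) (x y : V) :
    inner ℂ x (θ k y) = inner ℂ (θ k⁻¹ x) y := by
  rw [inner_apply_left, inv_inv]

/-- `U` is invariant under all `θ(k)`. -/
def Invariant (θ : UnitaryRep K V) (U : Submodule ℂ V) : Prop :=
  ∀ k, ∀ x ∈ U, θ k x ∈ U

/-- The restriction of a representation to an invariant subspace. -/
def subrep (θ : UnitaryRep K V) (U : Submodule ℂ V) (hU : θ.Invariant U) : UnitaryRep K U where
  toHom :=
    { toFun := fun k =>
        { toFun := fun x => ⟨θ k x, hU k x x.2⟩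
          invFun := fun x => ⟨θ k⁻¹ x, hU k⁻¹ x x.2⟩
          left_inv := fun x => Subtype.ext (θ.inv_apply_self k x)
          right_inv := fun x => Subtype.ext (θ.apply_inv_self k x)
          map_add' := fun x y => Subtype.ext (map_add (θ k) (x : V) y)
          map_smul' := fun c x => Subtype.ext (map_smul (θ k) c (x : V))
          norm_map' := fun x => (θ k).norm_map x }
      map_one' := by ext x; exact θ.one_apply x
      map_mul' := fun k l => by ext x; exact θ.mul_apply k l x }
  strongly_continuous := fun x => (θ.strongly_continuous x).subtype_mk _

@[simp]
theorem coe_subrep_apply (θ : UnitaryRep K V) (U : Submodule ℂ V) (hU : θ.Invariant U) (k : K)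
    (x : U) : ((θ.subrep U hU k x : U) : V) = θ k x := rfl

/-- Unlike in `Equivalent.trans`, the three spaces may lie in three universes: subrepresentations of
`θ` live in `Type v`, representatives of the dual in `Type w`. -/
theorem Equivalent.comp {V₁ V₂ V₃ : Type*} [NormedAddCommGroup V₁] [InnerProductSpace ℂ V₁]
    [NormedAddCommGroup V₂] [InnerProductSpace ℂ V₂] [NormedAddCommGroup V₃]
    [InnerProductSpace ℂ V₃] {θ₁ : UnitaryRep K V₁} {θ₂ : UnitaryRep K V₂} {θ₃ : UnitaryRep K V₃}
    (h : θ₁.Equivalent θ₂) (h' : θ₂.Equivalent θ₃) : θ₁.Equivalent θ₃ := by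
  obtain ⟨T, hT⟩ := h
  obtain ⟨T', hT'⟩ := h'
  exact ⟨T.trans T', fun k x => by simp [hT, hT']⟩

/-- Transport of a representation along a linear isometry equivalence. -/
def transport (θ : UnitaryRep K V) (T : V ≃ₗᵢ[ℂ] V') : UnitaryRep K V' where
  toHom :=
    { toFun := fun k => T.symm.trans ((θ k).trans T)
      map_one' := by ext x; simp
      map_mul' := fun k l => by ext x; simp }
  strongly_continuous := fun x => T.continuous.comp (θ.strongly_continuous (T.symm x))

@[simp]
theorem transport_apply (θ : UnitaryRep K V) (T : V ≃ₗᵢ[ℂ] V') (k : K) (x : V') :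
    θ.transport T k x = T (θ k (T.symm x)) := rfl

theorem equivalent_transport (θ : UnitaryRep K V) (T : V ≃ₗᵢ[ℂ] V') :
    θ.Equivalent (θ.transport T) :=
  ⟨T, fun k x => by simp⟩

theorem IsIrreducible.of_equivalent {θ : UnitaryRep K V} {θ' : UnitaryRep K V'}
    (hθ : θ.IsIrreducible) (h : θ.Equivalent θ') : θ'.IsIrreducible := by
  obtain ⟨T, hT⟩ := h
  have := hθ.1
  refine ⟨T.symm.toEquiv.nontrivial, fun U hU hinv => ?_⟩
  have key := hθ.2 (U.comap (T.toLinearEquiv : V →ₗ[ℂ] V')) (hU.preimage T.continuous)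
    (fun k x hx => by
      have := hinv k _ hx
      simpa [hT] using this)
  refine key.imp (fun h => ?_) (fun h => ?_)
  · rw [eq_bot_iff] at h ⊢
    intro y hy
    have := h (x := T.symm y) (by simpa using hy)
    simpa using this
  · rw [eq_top_iff] at h ⊢
    intro y _
    simpa using h (x := T.symm y) trivial

/-- **Schur's lemma**: an intertwiner of a finite-dimensional irreducible representation with
itself is scalar. -/
theorem IsIrreducible.exists_eq_smul [FiniteDimensional ℂ V] {θ : UnitaryRep K V}
    (hθ : θ.IsIrreducible) (A : V →L[ℂ] V) (hA : ∀ k x, A (θ k x) = θ k (A x)) :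
    ∃ c : ℂ, ∀ x, A x = c • x := by
  have := hθ.1
  obtain ⟨c, hc⟩ := Module.End.exists_eigenvalue (A : V →ₗ[ℂ] V)
  refine ⟨c, fun x => ?_⟩
  have htop := (hθ.2 (Module.End.eigenspace (A : V →ₗ[ℂ] V) c)
    (Submodule.closed_of_finiteDimensional _) (fun k x hx => by
      rw [Module.End.mem_eigenspace_iff] at hx ⊢
      simp only [ContinuousLinearMap.coe_coe] at hx ⊢
      rw [hA, hx, map_smul])).resolve_left hc
  have hx : x ∈ Module.End.eigenspace (A : V →ₗ[ℂ] V) c := htop ▸ Submodule.mem_top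
  simpa [Module.End.mem_eigenspace_iff] using hx

/-- A non-zero intertwiner into an irreducible representation from a finite-dimensional irreducible
one is a multiple of a unitary equivalence. -/
theorem IsIrreducible.equivalent_of_intertwiner [CompleteSpace V] [FiniteDimensional ℂ V']
    {θ : UnitaryRep K V} {θ' : UnitaryRep K V'} (hθ : θ.IsIrreducible) (hθ' : θ'.IsIrreducible)
    (B : V' →L[ℂ] V) (hB : ∀ k x, B (θ' k x) = θ k (B x)) (hB0 : B ≠ 0) :
    θ'.Equivalent θ := by
  have := hθ'.1
  have : CompleteSpace V' := FiniteDimensional.complete ℂ V'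
  -- `B* B` commutes with `θ'`, hence is a scalar `c`; so `B` scales all norms by one factor `r`
  -- with `r² = c`.
  obtain ⟨c, hc⟩ := hθ'.exists_eq_smul (ContinuousLinearMap.adjoint B ∘L B) (fun k x => by
    refine ext_inner_right ℂ fun y => ?_
    rw [inner_apply_left]
    simp only [ContinuousLinearMap.comp_apply, ContinuousLinearMap.adjoint_inner_left]
    rw [hB, hB, inner_apply_left])
  have hnorm : ∀ x, ((‖B x‖ ^ 2 : ℝ) : ℂ) = c * ((‖x‖ ^ 2 : ℝ) : ℂ) := fun x => by
    have h1 : inner ℂ x ((ContinuousLinearMap.adjoint B ∘L B) x) = inner ℂ (B x) (B x) := by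
      rw [ContinuousLinearMap.comp_apply, ContinuousLinearMap.adjoint_inner_right]
    rw [hc, inner_smul_right, inner_self_eq_norm_sq_to_K, inner_self_eq_norm_sq_to_K] at h1
    simpa using h1.symm
  obtain ⟨x₀, hx₀⟩ : ∃ x, B x ≠ 0 := by
    by_contra! h
    exact hB0 (ContinuousLinearMap.ext h)
  have hx₀' : x₀ ≠ 0 := fun h => hx₀ (by rw [h, map_zero])
  set r : ℝ := ‖B x₀‖ / ‖x₀‖ with hr
  have hrpos : 0 < r := div_pos (norm_pos_iff.2 hx₀) (norm_pos_iff.2 hx₀')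
  have hcr : c = ((r ^ 2 : ℝ) : ℂ) := by
    have h := hnorm x₀
    have hne : ((‖x₀‖ ^ 2 : ℝ) : ℂ) ≠ 0 := by
      exact_mod_cast pow_ne_zero 2 (norm_ne_zero_iff.2 hx₀')
    rw [hr, div_pow, Complex.ofReal_div, h, mul_div_cancel_right₀ _ hne]
  have hnorm' : ∀ x, ‖B x‖ = r * ‖x‖ := fun x => by
    have h := hnorm x
    rw [hcr] at h
    have h2 : ‖B x‖ ^ 2 = (r * ‖x‖) ^ 2 := by
      rw [mul_pow]; exact_mod_cast h
    exact (pow_left_inj₀ (norm_nonneg _) (by positivity) two_ne_zero).1 h2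
  let T : V' →ₗᵢ[ℂ] V :=
    { toLinearMap := ((r⁻¹ : ℝ) : ℂ) • (B : V' →ₗ[ℂ] V)
      norm_map' := fun x => by
        simp only [LinearMap.smul_apply, ContinuousLinearMap.coe_coe, norm_smul, hnorm',
          Complex.norm_real, Real.norm_eq_abs, abs_of_pos (inv_pos.2 hrpos)]
        field_simp }
  have hT : ∀ x, T x = ((r⁻¹ : ℝ) : ℂ) • B x := fun x => rfl
  have hrange : LinearMap.range T.toLinearMap = ⊤ := by
    refine (hθ.2 _ (Submodule.closed_of_finiteDimensional _) ?_).resolve_left ?_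
    · rintro k _ ⟨x, rfl⟩
      refine ⟨θ' k x, ?_⟩
      change T _ = θ k (T x)
      rw [hT, hT, hB, map_smul]
    · intro h
      have : T x₀ ∈ LinearMap.range T.toLinearMap := ⟨x₀, rfl⟩
      rw [h, Submodule.mem_bot, ← norm_eq_zero, T.norm_map, norm_eq_zero] at this
      exact hx₀' this
  refine ⟨LinearIsometryEquiv.ofSurjective T (LinearMap.range_eq_top.1 hrange), fun k x => ?_⟩
  change T _ = θ k (T x)
  rw [hT, hT, hB, map_smul]

end Subrepresentation

theorem integrable_of_continuous {K : Type u} [TopologicalSpace K] [CompactSpace K]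
    [MeasurableSpace K] [BorelSpace K] {E : Type*} [NormedAddCommGroup E] {f : K → E}
    (hf : Continuous f) (μ : Measure K) [IsFiniteMeasure μ] : Integrable f μ :=
  hf.integrable_of_hasCompactSupport (HasCompactSupport.of_compactSpace _)

/-! ### Haar averages of rank one operators and Schur orthogonality -/

section RankOne

open InnerProductSpace

/-- Strong continuity gives operator-norm continuity here because a rank one operator depends
continuously in norm on its two vectors; `avgRankOne` is thus a Bochner integral in operator norm.
-/
theorem continuous_rankOne {K : Type u} [Group K] [TopologicalSpace K]
    {V : Type v} [NormedAddCommGroup V] [InnerProductSpace ℂ V]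
    {V' : Type w} [NormedAddCommGroup V'] [InnerProductSpace ℂ V'] (θ : UnitaryRep K V) (θ' : UnitaryRep K V')
    (x : V) (y : V') :
    Continuous fun k => rankOne ℂ (θ k x) (θ' k y) :=
  (ContinuousLinearMap.smulRightL ℂ V' V).continuous₂.comp
    (((innerSL ℂ).continuous.comp (θ'.strongly_continuous y)).prodMk (θ.strongly_continuous x))

variable {K : Type u} [Group K] [TopologicalSpace K] [IsTopologicalGroup K] [CompactSpace K]
variable [MeasurableSpace K] [BorelSpace K]
variable {V : Type v} [NormedAddCommGroup V] [InnerProductSpace ℂ V]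
variable {V' : Type w} [NormedAddCommGroup V'] [InnerProductSpace ℂ V']

instance : IsProbabilityMeasure (haarProb K) :=
  ⟨by rw [haarProb]; exact Measure.haarMeasure_self⟩

instance : (haarProb K).IsHaarMeasure := by rw [haarProb]; infer_instance

/-- The average over `K` of the rank one operators `z ↦ ⟪θ'(k)y, z⟫ θ(k)x`. -/
def avgRankOne (θ : UnitaryRep K V) (θ' : UnitaryRep K V') (x : V) (y : V') : V' →L[ℂ] V :=
  ∫ k, rankOne ℂ (θ k x) (θ' k y) ∂haarProb K

theorem avgRankOne_apply (θ : UnitaryRep K V) (θ' : UnitaryRep K V') (x : V) (y z : V') :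
    avgRankOne θ θ' x y z = ∫ k, inner ℂ (θ' k y) z • θ k x ∂haarProb K := by
  rw [avgRankOne, ContinuousLinearMap.integral_apply
    (integrable_of_continuous (continuous_rankOne θ θ' x y) _)]
  simp

variable [CompleteSpace V]

theorem inner_avgRankOne (θ : UnitaryRep K V) (θ' : UnitaryRep K V') (x a : V) (y z : V') :
    inner ℂ a (avgRankOne θ θ' x y z)
      = ∫ k, inner ℂ (θ' k y) z * inner ℂ a (θ k x) ∂haarProb K := by
  rw [avgRankOne_apply, ← integral_inner]
  · simp [inner_smul_right]
  · exact integrable_of_continuous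
      (((θ'.strongly_continuous y).inner continuous_const).smul (θ.strongly_continuous x)) _

/-- Left invariance of Haar measure: substitute `k ↦ gk` and cancel `g` by unitarity. -/
theorem avgRankOne_intertwines (θ : UnitaryRep K V) (θ' : UnitaryRep K V') (x : V) (y : V')
    (g : K) (z : V') : avgRankOne θ θ' x y (θ' g z) = θ g (avgRankOne θ θ' x y z) := by
  refine ext_inner_left ℂ fun a => ?_
  rw [inner_apply_right, inner_avgRankOne, inner_avgRankOne,
    ← integral_mul_left_eq_self _ g]
  simp only [mul_apply, LinearIsometryEquiv.inner_map_map]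
  simp only [inner_apply_right θ g]

/-- Compact operators form a closed convex set, so an average of rank one operators stays in it. -/
theorem isCompactOperator_avgRankOne (θ : UnitaryRep K V) (θ' : UnitaryRep K V') (x : V)
    (y : V') : IsCompactOperator (avgRankOne θ θ' x y) := by
  have hconv : Convex ℝ {f : V' →L[ℂ] V | IsCompactOperator f} := by
    intro f hf g hg a b _ _ _
    exact (IsCompactOperator.smul (f := f) hf a).add (IsCompactOperator.smul (f := g) hg b)
  refine hconv.integral_mem isClosed_setOfPred_isCompactOperator
    (Filter.Eventually.of_forall fun k => ?_)
    (integrable_of_continuous (continuous_rankOne θ θ' x y) _)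
  change IsCompactOperator (rankOne ℂ (θ k x) (θ' k y))
  rw [rankOne_def', ContinuousLinearMap.coe_comp]
  exact (isCompactOperator_of_locallyCompactSpace_rng
    (ContinuousLinearMap.toSpanSingleton ℂ (θ k x))).comp_clm _

theorem isSymmetric_avgRankOne (θ : UnitaryRep K V) (x : V) :
    (avgRankOne θ θ x x).IsSymmetric := by
  intro a b
  simp only [ContinuousLinearMap.coe_coe]
  rw [← inner_conj_symm, inner_avgRankOne, inner_avgRankOne, ← integral_conj]
  congr 1
  ext k
  simp only [map_mul, inner_conj_symm]
  ring

/-- The quadratic form at `x` is the integral of `‖⟪x, θ(k)x⟫‖²`, a continuous non-negative function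
that is positive at `k = 1`. -/
theorem avgRankOne_self_ne_zero (θ : UnitaryRep K V) {x : V} (hx : x ≠ 0) :
    avgRankOne θ θ x x ≠ 0 := by
  intro h
  have h1 := inner_avgRankOne θ θ x x x x
  rw [h] at h1
  have hc : Continuous fun k => ‖inner ℂ x (θ k x)‖ ^ 2 :=
    (continuous_const.inner (θ.strongly_continuous x)).norm.pow 2
  have h2 : 0 < ∫ k, ‖inner ℂ x (θ k x)‖ ^ 2 ∂haarProb K := by
    refine hc.integral_pos_of_hasCompactSupport_nonneg_nonzero
      (HasCompactSupport.of_compactSpace _) (fun k => by positivity) (x := 1) ?_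
    rw [θ.one_apply]
    simpa using hx
  have h3 : ∀ k, inner ℂ (θ k x) x * inner ℂ x (θ k x)
      = ((‖inner ℂ x (θ k x)‖ ^ 2 : ℝ) : ℂ) := fun k => by
    rw [← inner_conj_symm (θ k x) x, ← Complex.normSq_eq_norm_sq, Complex.normSq_eq_conj_mul_self]
  simp only [h3, zero_apply, inner_zero_right] at h1
  rw [integral_complex_ofReal] at h1
  exact h2.ne (by exact_mod_cast h1)

/-- Schur orthogonality within one irreducible representation. -/
theorem IsIrreducible.integral_norm_inner_sq [FiniteDimensional ℂ V] {θ : UnitaryRep K V}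
    (hθ : θ.IsIrreducible) (a x : V) :
    Module.finrank ℂ V * ∫ k, ‖inner ℂ a (θ k x)‖ ^ 2 ∂haarProb K = ‖a‖ ^ 2 * ‖x‖ ^ 2 := by
  obtain ⟨c, hc⟩ := hθ.exists_eq_smul (avgRankOne θ θ x x)
    (fun k z => avgRankOne_intertwines θ θ x x k z)
  have h3 : ∀ b : V, ((∫ k, ‖inner ℂ b (θ k x)‖ ^ 2 ∂haarProb K : ℝ) : ℂ) = c * (‖b‖ ^ 2 : ℝ) := by
    intro b
    have h := inner_avgRankOne θ θ x b x b
    have h3 : ∀ k, inner ℂ (θ k x) b * inner ℂ b (θ k x)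
        = ((‖inner ℂ b (θ k x)‖ ^ 2 : ℝ) : ℂ) := fun k => by
      rw [← inner_conj_symm (θ k x) b, ← Complex.normSq_eq_norm_sq,
        Complex.normSq_eq_conj_mul_self]
    simp only [h3] at h
    rw [integral_complex_ofReal, hc, inner_smul_right, inner_self_eq_norm_sq_to_K] at h
    rw [← h]
    simp
  let e := stdOrthonormalBasis ℂ V
  -- Taking the trace identifies the Schur scalar: summing over an orthonormal basis turns the
  -- integrand into the constant `‖x‖²`.
  have hsum : (Module.finrank ℂ V : ℂ) * c = ((‖x‖ ^ 2 : ℝ) : ℂ) := by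
    have h4 : ∑ i, ((∫ k, ‖inner ℂ (e i) (θ k x)‖ ^ 2 ∂haarProb K : ℝ) : ℂ)
        = (Module.finrank ℂ V : ℂ) * c := by
      simp [h3]
    rw [← h4, ← Complex.ofReal_sum, ← integral_finsetSum]
    · congr 1
      have : ∀ k, ∑ i, ‖inner ℂ (e i) (θ k x)‖ ^ 2 = ‖x‖ ^ 2 := fun k => by
        rw [e.sum_sq_norm_inner_right, LinearIsometryEquiv.norm_map]
      simp [this]
    · intro i _
      exact integrable_of_continuous
        ((continuous_const.inner (θ.strongly_continuous x)).norm.pow 2) _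
  have h5 : ((Module.finrank ℂ V * ∫ k, ‖inner ℂ a (θ k x)‖ ^ 2 ∂haarProb K : ℝ) : ℂ)
      = ((‖a‖ ^ 2 * ‖x‖ ^ 2 : ℝ) : ℂ) := by
    rw [Complex.ofReal_mul, h3, Complex.ofReal_mul, ← hsum]
    push_cast
    ring
  exact_mod_cast h5

/-- Schur orthogonality for inequivalent irreducible representations. -/
theorem IsIrreducible.integral_inner_mul_inner_eq_zero [FiniteDimensional ℂ V']
    {θ : UnitaryRep K V} {θ' : UnitaryRep K V'} (hθ : θ.IsIrreducible) (hθ' : θ'.IsIrreducible)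
    (h : ¬ θ'.Equivalent θ) (a x : V) (y z : V') :
    ∫ k, inner ℂ (θ' k y) z * inner ℂ a (θ k x) ∂haarProb K = 0 := by
  by_cases hB : avgRankOne θ θ' x y = 0
  · rw [← inner_avgRankOne, hB]; simp
  · exact absurd (hθ.equivalent_of_intertwiner hθ' _ (avgRankOne_intertwines θ θ' x y) hB) h

end RankOne

end UnitaryRep

/-- A bounded operator preserving each member of a pairwise orthogonal family of subspaces is
bounded on their closed span by any common bound on the members. -/
theorem norm_apply_le_of_pairwise_isOrtho {V : Type*} [NormedAddCommGroup V]
    [InnerProductSpace ℂ V] {F : Set (Submodule ℂ V)} (hF : F.Pairwise (· ⟂ ·)) (T : V →L[ℂ] V)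
    (hT : ∀ U ∈ F, ∀ x ∈ U, T x ∈ U) {c : ℝ} (hc : 0 ≤ c)
    (hb : ∀ U ∈ F, ∀ x ∈ U, ‖T x‖ ≤ c * ‖x‖) {x : V} (hx : x ∈ (sSup F).topologicalClosure) :
    ‖T x‖ ≤ c * ‖x‖ := by
  classical
  have hclosed : IsClosed {x : V | ‖T x‖ ≤ c * ‖x‖} :=
    isClosed_le (by fun_prop) (by fun_prop)
  refine hclosed.closure_subset_iff.2 ?_ hx
  intro x hx
  have horth : OrthogonalFamily ℂ (fun U : F => (U : Submodule ℂ V))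
      fun U => (U : Submodule ℂ V).subtypeₗᵢ :=
    OrthogonalFamily.of_pairwise fun U W h => hF U.2 W.2 (fun h' => h (Subtype.ext h'))
  replace hx : x ∈ sSup F := hx
  rw [sSup_eq_iSup', Submodule.mem_iSup_iff_exists_dfinsupp'] at hx
  obtain ⟨f, rfl⟩ := hx
  have h1 : ‖∑ U ∈ f.support, (f U : V)‖ ^ 2 = ∑ U ∈ f.support, ‖(f U : V)‖ ^ 2 :=
    horth.norm_sum (fun U => f U) f.support
  -- Since `T` preserves each subspace, the images are again pairwise orthogonal and Pythagoras
  -- applies to them too.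
  have h2 : ‖∑ U ∈ f.support, T (f U)‖ ^ 2 = ∑ U ∈ f.support, ‖T (f U)‖ ^ 2 :=
    horth.norm_sum (fun U => ⟨T (f U), hT U U.2 _ (f U).2⟩) f.support
  refine (pow_le_pow_iff_left₀ (norm_nonneg _) (by positivity) two_ne_zero).1 ?_
  rw [DFinsupp.sum, map_sum, h2, mul_pow, h1, Finset.mul_sum]
  refine Finset.sum_le_sum fun U _ => ?_
  rw [← mul_pow]
  exact pow_le_pow_left₀ (norm_nonneg _) (hb U U.2 _ (f U).2) 2

theorem map_subtype_ne_bot {R M : Type*} [Ring R] [AddCommGroup M] [Module R M]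
    {W : Submodule R M} {E : Submodule R W} (h : E ≠ ⊥) : E.map W.subtype ≠ ⊥ := fun h' =>
  h (Submodule.map_injective_of_injective W.subtype_injective (by rw [h', Submodule.map_bot]))

namespace UnitaryRep

/-! ### Invariant subspaces and finite-dimensional irreducibles -/

section Invariant

variable {K : Type u} [Group K] [TopologicalSpace K]
variable {V : Type v} [NormedAddCommGroup V] [InnerProductSpace ℂ V]

theorem invariant_sSup {θ : UnitaryRep K V} {F : Set (Submodule ℂ V)}
    (hF : ∀ U ∈ F, θ.Invariant U) : θ.Invariant (sSup F) := by
  intro k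
  suffices sSup F ≤ (sSup F).comap ((θ k).toLinearEquiv : V →ₗ[ℂ] V) from
    fun x hx => this hx
  exact sSup_le fun U hU x hx => (le_sSup hU : U ≤ _) (hF U hU k x hx)

theorem Invariant.topologicalClosure {θ : UnitaryRep K V} {U : Submodule ℂ V}
    (hU : θ.Invariant U) : θ.Invariant U.topologicalClosure := fun k _ hx =>
  map_mem_closure (θ k).continuous hx (hU k)

theorem Invariant.orthogonal {θ : UnitaryRep K V} {U : Submodule ℂ V}
    (hU : θ.Invariant U) : θ.Invariant Uᗮ := by
  intro k x hx u hu
  rw [inner_apply_right]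
  exact hx _ (hU _ _ hu)

theorem invariant_fixed (θ : UnitaryRep K V) : θ.Invariant θ.fixed := fun k x hx => by
  rwa [hx k]

theorem bddAbove_seminorm (θ : UnitaryRep K V) (k : K) :
    BddAbove {r : ℝ | ∃ x : V, ‖x‖ = 1 ∧ r = ‖θ k x - x‖} := by
  refine ⟨2, ?_⟩
  rintro r ⟨x, hx, rfl⟩
  refine (norm_sub_le _ _).trans ?_
  rw [LinearIsometryEquiv.norm_map, hx]
  norm_num

theorem seminorm_le_two (θ : UnitaryRep K V) (k : K) : θ.seminorm k ≤ 2 := by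
  refine Real.sSup_le ?_ (by norm_num)
  rintro r ⟨x, hx, rfl⟩
  refine (norm_sub_le _ _).trans ?_
  rw [LinearIsometryEquiv.norm_map, hx]
  norm_num

theorem seminorm_nonneg (θ : UnitaryRep K V) (k : K) : 0 ≤ θ.seminorm k := by
  refine Real.sSup_nonneg ?_
  rintro r ⟨x, hx, rfl⟩
  exact norm_nonneg _

theorem norm_apply_sub_le (θ : UnitaryRep K V) (k : K) (x : V) :
    ‖θ k x - x‖ ≤ θ.seminorm k * ‖x‖ := by
  rcases eq_or_ne x 0 with rfl | hx
  · simp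
  have hx' : (‖x‖ : ℂ) ≠ 0 := by exact_mod_cast norm_ne_zero_iff.2 hx
  have h := le_csSup (θ.bddAbove_seminorm k)
    ⟨(‖x‖ : ℂ)⁻¹ • x, norm_smul_inv_norm hx, rfl⟩
  rw [map_smul, ← smul_sub, norm_smul, norm_inv, Complex.norm_real, norm_norm,
    inv_mul_le_iff₀ (norm_pos_iff.2 hx)] at h
  rw [mul_comm]
  exact h

/-- A finite-dimensional irreducible representation with a non-zero invariant functional is
trivial. -/
theorem IsIrreducible.equivalent_trivial [FiniteDimensional ℂ V] {θ : UnitaryRep K V}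
    (hθ : θ.IsIrreducible) (ℓ : V →L[ℂ] ℂ) (hℓ : ∀ k x, ℓ (θ k x) = ℓ x) (h0 : ℓ ≠ 0) :
    θ.Equivalent (UnitaryIrrep.trivial.{u, w} K).rep := by
  have := (UnitaryIrrep.trivial.{u, w} K).irreducible.1
  obtain ⟨e, he⟩ := exists_ne (0 : (UnitaryIrrep.trivial.{u, w} K).space)
  -- An invariant functional times a fixed non-zero vector is an intertwiner into the trivial
  -- representation.
  refine (UnitaryIrrep.trivial.{u, w} K).irreducible.equivalent_of_intertwiner hθ
    (ℓ.smulRight e) (fun k x => ?_) (fun h => h0 ?_)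
  · rw [ContinuousLinearMap.smulRight_apply, hℓ]
    rfl
  · ext x
    have hx : ℓ x • e = 0 := congrArg (fun B => B x) h
    exact (smul_eq_zero.1 hx).resolve_right he

theorem Equivalent.apply_eq_of_trivial {θ : UnitaryRep K V}
    (h : θ.Equivalent (UnitaryIrrep.trivial.{u, w} K).rep) (k : K) (x : V) : θ k x = x := by
  obtain ⟨T, hT⟩ := h
  exact T.injective (hT k x)

/-- Every finite-dimensional irreducible representation is equivalent to one in any universe. -/
theorem IsIrreducible.exists_equivalent [FiniteDimensional ℂ V] {θ : UnitaryRep K V}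
    (hθ : θ.IsIrreducible) : ∃ σ : UnitaryIrrep.{u, w} K, θ.Equivalent σ.rep := by
  let T := ((stdOrthonormalBasis ℂ V).reindex Equiv.ulift.{w}.symm).repr
  exact ⟨⟨_, θ.transport T, hθ.of_equivalent (θ.equivalent_transport T)⟩,
    θ.equivalent_transport T⟩

/-- `U` is a finite-dimensional irreducible subrepresentation of `θ`. -/
def IsFiniteIrreducible (θ : UnitaryRep K V) (U : Submodule ℂ V) : Prop :=
  FiniteDimensional ℂ U ∧ ∃ hU : θ.Invariant U, (θ.subrep U hU).IsIrreducible

/-- Every non-zero finite-dimensional invariant subspace contains an irreducible one. -/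
theorem exists_isFiniteIrreducible_le_of_finiteDimensional (θ : UnitaryRep K V)
    {W : Submodule ℂ V} (hW : θ.Invariant W) (hfin : FiniteDimensional ℂ W) (h0 : W ≠ ⊥) :
    ∃ U ≤ W, θ.IsFiniteIrreducible U := by
  classical
  -- A non-zero invariant subspace of least dimension is irreducible.
  have hex : ∃ n, ∃ U ≤ W, θ.Invariant U ∧ U ≠ ⊥ ∧ Module.finrank ℂ U = n :=
    ⟨_, W, le_rfl, hW, h0, rfl⟩
  obtain ⟨U, hUW, hU, hU0, hUn⟩ := Nat.find_spec hex
  have hUfin : FiniteDimensional ℂ U := Submodule.finiteDimensional_of_le hUW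
  refine ⟨U, hUW, hUfin, hU, Submodule.nontrivial_iff_ne_bot.2 hU0, fun X _ hX => ?_⟩
  refine or_iff_not_imp_left.2 fun hX0 => ?_
  have hmin := Nat.find_min' hex ⟨X.map U.subtype, (Submodule.map_subtype_le U X).trans hUW, ?_, ?_,
    rfl⟩
  · rw [Submodule.finrank_map_subtype_eq, ← hUn] at hmin
    exact Submodule.eq_top_of_finrank_eq (le_antisymm (Submodule.finrank_le X) hmin)
  · rintro k _ ⟨x, hx, rfl⟩
    exact ⟨_, hX k x hx, rfl⟩
  · exact map_subtype_ne_bot hX0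

/-- Pairing with a fixed vector is an invariant functional on `U`; were it non-zero, `U` would be
trivial. -/
theorem isOrtho_fixed {θ : UnitaryRep K V} {U : Submodule ℂ V}
    (hU : θ.Invariant U) (hfin : FiniteDimensional ℂ U) (hirr : (θ.subrep U hU).IsIrreducible)
    (hne : ¬ (θ.subrep U hU).Equivalent (UnitaryIrrep.trivial.{u, w} K).rep) :
    θ.fixed ⟂ U := by
  rw [Submodule.isOrtho_iff_inner_eq]
  intro x hx y hy
  by_contra h
  refine hne (hirr.equivalent_trivial ((innerSL ℂ x).comp U.subtypeL) (fun k z => ?_) fun h0 => ?_)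
  · simp only [ContinuousLinearMap.comp_apply, Submodule.subtypeL_apply, coe_subrep_apply,
      innerSL_apply_apply]
    rw [inner_apply_right, hx]
  · exact h (by simpa using congrArg (fun L => L ⟨y, hy⟩) h0)

end Invariant

/-! ### Peter–Weyl decomposition -/

section PeterWeyl

variable {K : Type u} [Group K] [TopologicalSpace K] [IsTopologicalGroup K] [CompactSpace K]
variable [MeasurableSpace K] [BorelSpace K]
variable {V : Type v} [NormedAddCommGroup V] [InnerProductSpace ℂ V] [CompleteSpace V]

/-- The operator `avgRankOne θ θ x x` is compact, symmetric and non-zero, so it has a non-zero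
eigenvalue; that eigenspace is finite-dimensional, and invariant because the operator intertwines.
-/
theorem exists_finiteDimensional_invariant (θ : UnitaryRep K V) [Nontrivial V] :
    ∃ E : Submodule ℂ V, FiniteDimensional ℂ E ∧ E ≠ ⊥ ∧ θ.Invariant E := by
  obtain ⟨x, hx⟩ := exists_ne (0 : V)
  have hcomp := isCompactOperator_avgRankOne θ θ x x
  have hne := θ.avgRankOne_self_ne_zero hx
  rw [Ne, ← ContinuousLinearMap.eq_zero_of_forall_hasEigenvalue_eq_zero hcomp
    (θ.isSymmetric_avgRankOne x)] at hne
  push Not at hne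
  obtain ⟨c, hc, hc0⟩ := hne
  refine ⟨_, ContinuousLinearMap.finite_dimensional_eigenspace hcomp c hc0, hc, fun k y hy => ?_⟩
  rw [Module.End.mem_eigenspace_iff, ContinuousLinearMap.coe_coe] at hy ⊢
  rw [avgRankOne_intertwines, hy, map_smul]

theorem exists_isFiniteIrreducible_le (θ : UnitaryRep K V) {W : Submodule ℂ V}
    (hW : θ.Invariant W) (hcl : IsClosed (W : Set V)) (h0 : W ≠ ⊥) :
    ∃ U ≤ W, θ.IsFiniteIrreducible U := by
  have : CompleteSpace W := hcl.completeSpace_coe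
  have : Nontrivial W := Submodule.nontrivial_iff_ne_bot.2 h0
  obtain ⟨E, hfin, hE0, hE⟩ := (θ.subrep W hW).exists_finiteDimensional_invariant
  obtain ⟨U, hUE, hU⟩ := θ.exists_isFiniteIrreducible_le_of_finiteDimensional
    (W := E.map W.subtype) (by
      rintro k _ ⟨x, hx, rfl⟩
      exact ⟨_, hE k x hx, rfl⟩) inferInstance
    (map_subtype_ne_bot hE0)
  exact ⟨U, hUE.trans (Submodule.map_subtype_le W E), hU⟩

theorem IsIrreducible.finiteDimensional {θ : UnitaryRep K V} (hθ : θ.IsIrreducible) :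
    FiniteDimensional ℂ V := by
  have := hθ.1
  obtain ⟨E, hfin, hE0, hE⟩ := θ.exists_finiteDimensional_invariant
  have htop := (hθ.2 E (Submodule.closed_of_finiteDimensional E) hE).resolve_left hE0
  subst htop
  exact Module.Finite.equiv (Submodule.topEquiv (R := ℂ) (M := V))

/-- **Peter–Weyl**: every representation has a pairwise orthogonal family of finite-dimensional
irreducible subrepresentations with dense span. -/
theorem exists_orthogonal_decomposition (θ : UnitaryRep K V) :
    ∃ F : Set (Submodule ℂ V), (∀ U ∈ F, θ.IsFiniteIrreducible U) ∧ F.Pairwise (· ⟂ ·) ∧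
      (sSup F)ᗮ = ⊥ := by
  obtain ⟨F, hF⟩ := zorn_subset
    {F : Set (Submodule ℂ V) | (∀ U ∈ F, θ.IsFiniteIrreducible U) ∧ F.Pairwise (· ⟂ ·)}
    (fun c hc hchain => ⟨⋃₀ c, ⟨fun U ⟨G, hG, hUG⟩ => (hc hG).1 U hUG,
      (Set.pairwise_sUnion hchain.directedOn).2 fun G hG => (hc hG).2⟩,
      fun G hG => Set.subset_sUnion_of_mem hG⟩)
  refine ⟨F, hF.prop.1, hF.prop.2, ?_⟩
  by_contra h0
  have hinv : θ.Invariant (sSup F)ᗮ :=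
    (invariant_sSup fun U hU => (hF.prop.1 U hU).2.1).orthogonal
  obtain ⟨U, hUW, hU⟩ :=
    θ.exists_isFiniteIrreducible_le hinv (Submodule.isClosed_orthogonal _) h0
  have hUo : ∀ W ∈ F, U ⟂ W := fun W hW =>
    hUW.trans (Submodule.orthogonal_le (le_sSup hW))
  have hmem : U ∈ F := by
    -- Maximality puts `U` in `F`, although `U` is orthogonal to every member of `F`; so `U ⟂ U`,
    -- which is absurd.
    refine hF.le_of_ge (y := insert U F) ⟨?_, ?_⟩ (Set.subset_insert U F) (Set.mem_insert U F)
    · rintro W (rfl | hW)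
      exacts [hU, hF.prop.1 W hW]
    · exact hF.prop.2.insert_of_symm fun W hW _ => hUo W hW
  have hbot : U = ⊥ := Submodule.isOrtho_self.1 (hUo U hmem)
  obtain ⟨_, _, hirr⟩ := hU
  exact Submodule.nontrivial_iff_ne_bot.1 hirr.1 hbot

end PeterWeyl

/-! ### The averaging operator `θ(μ)` -/

section Average

variable {K : Type u} [Group K] [TopologicalSpace K] [CompactSpace K]
variable [MeasurableSpace K] [BorelSpace K]
variable {V : Type v} [NormedAddCommGroup V] [InnerProductSpace ℂ V]

theorem norm_avg_apply_le (θ : UnitaryRep K V) (μ : Measure K) [IsProbabilityMeasure μ] (x : V) :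
    ‖θ.avg μ x‖ ≤ ‖x‖ :=
  (norm_integral_le_of_norm_le_const (C := ‖x‖)
    (Filter.Eventually.of_forall fun k => ((θ k).norm_map x).le)).trans (by simp)

variable [CompleteSpace V]

theorem avg_mem (θ : UnitaryRep K V) (μ : Measure K) [IsProbabilityMeasure μ] {U : Submodule ℂ V}
    (hU : θ.Invariant U) (hcl : IsClosed (U : Set V)) {x : V} (hx : x ∈ U) : θ.avg μ x ∈ U :=
  (U.restrictScalars ℝ).convex.integral_mem hcl
    (Filter.Eventually.of_forall fun k => hU k x hx) (θ.integrable μ x)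

theorem coe_avg_subrep (θ : UnitaryRep K V) (μ : Measure K) [IsProbabilityMeasure μ]
    {U : Submodule ℂ V} [CompleteSpace U] (hU : θ.Invariant U) (x : U) :
    (((θ.subrep U hU).avg μ x : U) : V) = θ.avg μ x :=
  (U.subtypeₗᵢ.integral_comp_comm _).symm

theorem avg_eq_self (θ : UnitaryRep K V) (μ : Measure K) [IsProbabilityMeasure μ] {x : V}
    (hx : ∀ k, θ k x = x) : θ.avg μ x = x := by
  simp [avg_apply, hx]

theorem inner_avg_left (θ : UnitaryRep K V) (μ : Measure K) [IsProbabilityMeasure μ] (x y : V) :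
    inner ℂ y (θ.avg μ x) = ∫ k, inner ℂ y (θ k x) ∂μ :=
  (integral_inner (θ.integrable μ x) y).symm

theorem inner_avg_apply_eq_zero (θ : UnitaryRep K V) (μ : Measure K)
    [IsProbabilityMeasure μ] {U W : Submodule ℂ V} (hU : θ.Invariant U)
    (hW : θ.Invariant W) (hcl : IsClosed (U : Set V)) (h : U ⟂ W) {x y : V} (hx : x ∈ U)
    (hy : y ∈ W) (k : K) : inner ℂ (θ.avg μ x) (θ k y) = 0 :=
  Submodule.isOrtho_iff_inner_eq.1 h _ (θ.avg_mem μ hU hcl hx) _ (hW k y hy)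

/-- Some point of the support does at least as well as the average. -/
theorem exists_mem_support_re_inner_avg_nonneg (θ : UnitaryRep K V) (μ : Measure K)
    [IsProbabilityMeasure μ] [T2Space K] [μ.Regular] (x : V) :
    ∃ k ∈ μ.support, 0 ≤ (inner ℂ (θ.avg μ x) (θ k x)).re := by
  have hint : Integrable (fun k => (inner ℂ (θ.avg μ x) (θ k x)).re) μ :=
    integrable_of_continuous
      (Complex.continuous_re.comp (continuous_const.inner (θ.strongly_continuous x))) μ
  -- Regularity makes the complement of the support null, so a point doing at least as well as the
  -- mean can be found inside the support.
  obtain ⟨k, hk, hle⟩ := exists_notMem_null_integral_le hint μ.measure_compl_support_of_regular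
  refine ⟨k, not_not.1 hk, le_trans ?_ hle⟩
  have h : ∫ k, (inner ℂ (θ.avg μ x) (θ k x)).re ∂μ = ‖θ.avg μ x‖ ^ 2 := by
    rw [← inner_self_eq_norm_sq (𝕜 := ℂ), inner_avg_left]
    exact integral_re (𝕜 := ℂ) (integrable_of_continuous
      (continuous_const.inner (θ.strongly_continuous x)) μ)
  rw [h]
  positivity

end Average

end UnitaryRep

/-! ### Bounds for `|k|_σ` and `|k|_S` -/

namespace UnitaryDual

variable {K : Type u} [Group K] [TopologicalSpace K]

theorem seminorm_le_two (c : UnitaryDual.{u, w} K) (k : K) : c.seminorm k ≤ 2 := by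
  induction c using Quotient.inductionOn with
  | h σ => exact σ.rep.seminorm_le_two k

theorem seminorm_nonneg (c : UnitaryDual.{u, w} K) (k : K) : 0 ≤ c.seminorm k := by
  induction c using Quotient.inductionOn with
  | h σ => exact σ.rep.seminorm_nonneg k

theorem seminormOn_nonneg (S : Set (UnitaryDual.{u, w} K)) (k : K) : 0 ≤ seminormOn S k := by
  refine Real.sSup_nonneg ?_
  rintro r ⟨c, _, rfl⟩
  exact c.seminorm_nonneg k

theorem seminorm_le_seminormOn {S : Set (UnitaryDual.{u, w} K)} {c : UnitaryDual.{u, w} K}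
    (hc : c ∈ S) (k : K) : c.seminorm k ≤ seminormOn S k := by
  refine le_csSup ⟨2, ?_⟩ ⟨c, hc, rfl⟩
  rintro r ⟨c, _, rfl⟩
  exact c.seminorm_le_two k

end UnitaryDual

namespace UnitaryRep

/-! ### Spectral splitting and the lower bound -/

section Decomposition

variable {K : Type u} [Group K] [TopologicalSpace K] [IsTopologicalGroup K] [CompactSpace K]
variable [MeasurableSpace K] [BorelSpace K]
variable (μ : Measure K) [IsProbabilityMeasure μ]
variable {V : Type v} [NormedAddCommGroup V] [InnerProductSpace ℂ V] [CompleteSpace V]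

/-- The representation space splits into the fixed vectors, a part on which `θ(k)` moves vectors by
at most `|k|_S`, `S = S_δ`, and a part on which `θ(μ)` has norm at most `δ`. -/
theorem exists_spectral_splitting (θ : UnitaryRep K V) {δ : ℝ} (hδ : 0 ≤ δ) :
    ∃ E₁ E₂ : Submodule ℂ V, IsClosed (E₁ : Set V) ∧ IsClosed (E₂ : Set V) ∧
      θ.Invariant E₁ ∧ θ.Invariant E₂ ∧ θ.fixed ⟂ E₁ ∧ θ.fixed ⟂ E₂ ∧ E₁ ⟂ E₂ ∧
      (θ.fixed ⊔ E₁ ⊔ E₂)ᗮ = ⊥ ∧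
      (∀ k, ∀ x ∈ E₁, ‖θ k x - x‖ ≤
        UnitaryDual.seminormOn (UnitaryDual.large.{u, w} μ δ) k * ‖x‖) ∧
      (∀ x ∈ E₂, ‖θ.avg μ x‖ ≤ δ * ‖x‖) := by
  obtain ⟨F, hF, hort, hdense⟩ := θ.exists_orthogonal_decomposition
  let F₁ : Set (Submodule ℂ V) := {U ∈ F | ∃ hU : θ.Invariant U, ∃ σ : UnitaryIrrep.{u, w} K,
    (θ.subrep U hU).Equivalent σ.rep ∧ (⟦σ⟧ : UnitaryDual.{u, w} K) ∈ UnitaryDual.large.{u, w} μ δ}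
  let F₂ : Set (Submodule ℂ V) := {U ∈ F | ∃ hU : θ.Invariant U, ∃ σ : UnitaryIrrep.{u, w} K,
    (θ.subrep U hU).Equivalent σ.rep ∧ (⟦σ⟧ : UnitaryDual.{u, w} K) ≠ UnitaryDual.triv K ∧
      UnitaryDual.normAvg (⟦σ⟧ : UnitaryDual.{u, w} K) μ ≤ δ}
  have hinv₁ : θ.Invariant (sSup F₁) := invariant_sSup fun U hU => (hF U hU.1).2.1
  have hinv₂ : θ.Invariant (sSup F₂) := invariant_sSup fun U hU => (hF U hU.1).2.1
  have hfix : ∀ U ∈ F, ∀ (hU : θ.Invariant U) (σ : UnitaryIrrep.{u, w} K),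
      (θ.subrep U hU).Equivalent σ.rep → (⟦σ⟧ : UnitaryDual.{u, w} K) ≠ UnitaryDual.triv K →
      θ.fixed ⟂ U := by
    intro U hUF hU σ hσ hne
    obtain ⟨hfin, _, hirr⟩ := hF U hUF
    exact isOrtho_fixed.{u, v, w} hU hfin hirr fun h => hne (Quotient.sound (hσ.symm.comp h))
  have hclosure : ∀ {A B : Submodule ℂ V}, A ⟂ B → A ⟂ B.topologicalClosure := fun {A B} h =>
    Submodule.IsOrtho.symm
      (Submodule.topologicalClosure_minimal _ h.symm (Submodule.isClosed_orthogonal A))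
  -- Distinct members of `F` are orthogonal; a common member would have a class both inside and
  -- outside `S_δ`.
  have h12 : ∀ U ∈ F₁, ∀ W ∈ F₂, U ⟂ W := by
    rintro U ⟨hUF, hU, σ, hσ, hσl⟩ W ⟨hWF, hW, τ, hτ, -, hτl⟩
    refine hort hUF hWF ?_
    rintro rfl
    have hστ : (⟦σ⟧ : UnitaryDual.{u, w} K) = ⟦τ⟧ := Quotient.sound (hσ.symm.comp hτ)
    rw [hστ] at hσl
    exact absurd hσl.2 (not_lt.2 hτl)
  refine ⟨(sSup F₁).topologicalClosure, (sSup F₂).topologicalClosure,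
    Submodule.isClosed_topologicalClosure _, Submodule.isClosed_topologicalClosure _,
    hinv₁.topologicalClosure, hinv₂.topologicalClosure, hclosure ?_, hclosure ?_,
    hclosure (hclosure ?_).symm, ?_, fun k x hx => ?_, fun x hx => ?_⟩
  · refine Submodule.isOrtho_sSup_right.2 ?_
    rintro U ⟨hUF, hU, σ, hσ, hσl⟩
    exact hfix U hUF hU σ hσ hσl.1
  · refine Submodule.isOrtho_sSup_right.2 ?_
    rintro U ⟨hUF, hU, σ, hσ, hne, -⟩
    exact hfix U hUF hU σ hσ hne
  · exact Submodule.isOrtho_sSup_right.2 fun U hU =>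
      Submodule.isOrtho_sSup_left.2 fun W hW => (h12 U hU W hW).symm
  · rw [eq_bot_iff, ← hdense]
    refine Submodule.orthogonal_le (sSup_le fun U hUF => ?_)
    obtain ⟨hfin, hU, hirr⟩ := hF U hUF
    obtain ⟨σ, hσ⟩ := hirr.exists_equivalent
    by_cases ht : (⟦σ⟧ : UnitaryDual.{u, w} K) = UnitaryDual.triv K
    · refine le_trans ?_ (le_sup_left.trans le_sup_left)
      have ht' := hσ.comp (Quotient.exact ht)
      exact fun x hx k => congrArg Subtype.val (ht'.apply_eq_of_trivial k ⟨x, hx⟩)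
    by_cases hl : δ < UnitaryDual.normAvg (⟦σ⟧ : UnitaryDual.{u, w} K) μ
    · have hmem : U ∈ F₁ := ⟨hUF, hU, σ, hσ, ht, hl⟩
      exact (le_sSup hmem).trans ((Submodule.le_topologicalClosure _).trans
        (le_sup_right.trans le_sup_left))
    · have hmem : U ∈ F₂ := ⟨hUF, hU, σ, hσ, ht, not_lt.1 hl⟩
      exact (le_sSup hmem).trans ((Submodule.le_topologicalClosure _).trans le_sup_right)
  · refine norm_apply_le_of_pairwise_isOrtho (F := F₁) (hort.mono fun U hU => hU.1)
      ((θ k).toContinuousLinearEquiv.toContinuousLinearMap - ContinuousLinearMap.id ℂ V) ?_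
      (UnitaryDual.seminormOn_nonneg _ k) ?_ hx
    · rintro U ⟨-, hU, -⟩ y hy
      exact U.sub_mem (hU k y hy) hy
    · rintro U ⟨-, hU, σ, hσ, hσl⟩ y hy
      have h1 := (θ.subrep U hU).norm_apply_sub_le k ⟨y, hy⟩
      rw [hσ.seminorm_eq] at h1
      exact h1.trans (mul_le_mul_of_nonneg_right (UnitaryDual.seminorm_le_seminormOn hσl k)
        (norm_nonneg _))
  · refine norm_apply_le_of_pairwise_isOrtho (F := F₂) (hort.mono fun U hU => hU.1)
      (θ.avg μ) ?_ hδ ?_ hx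
    · rintro U ⟨hUF, hU, -⟩ y hy
      have := (hF U hUF).1
      exact θ.avg_mem μ hU (Submodule.closed_of_finiteDimensional U) hy
    · rintro U ⟨hUF, hU, σ, hσ, -, hle⟩ y hy
      have := (hF U hUF).1
      have : CompleteSpace U := FiniteDimensional.complete ℂ U
      rw [← θ.coe_avg_subrep μ hU ⟨y, hy⟩]
      refine ((θ.subrep U hU).avg μ).le_of_opNorm_le ?_ ⟨y, hy⟩
      exact (hσ.norm_avg_le μ).trans hle

/-- Expanding along the splitting leaves three diagonal terms, bounded separately. The constant is
`δ`, since only the `E₂` term needs it. -/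
theorem exists_mem_support_re_inner_avg_ge [T2Space K] [μ.Regular] (θ : UnitaryRep K V) {δ : ℝ}
    (hδ : 0 ≤ δ) (x : V) : ∃ k₀ ∈ μ.support, ∀ k : K,
      ‖θ.fixedProj x‖ ^ 2
          - (δ + UnitaryDual.seminormOn (UnitaryDual.large.{u, w} μ δ) k) * ‖x‖ ^ 2
        ≤ (inner ℂ (θ.avg μ x) (θ (k₀ * k) x)).re := by
  obtain ⟨E₁, E₂, hcl₁, hcl₂, hinv₁, hinv₂, h01, h02, h12, hdense, hb₁, hb₂⟩ :=
    θ.exists_spectral_splitting.{u, v, w} μ hδ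
  have := hcl₁.completeSpace_coe
  have := hcl₂.completeSpace_coe
  set x₀ := θ.fixedProj x with hx₀
  set x₁ := E₁.starProjection x with hx₁
  set x₂ := E₂.starProjection x with hx₂
  have hm₀ : x₀ ∈ θ.fixed := Submodule.starProjection_apply_mem _ _
  have hm₁ : x₁ ∈ E₁ := Submodule.starProjection_apply_mem _ _
  have hm₂ : x₂ ∈ E₂ := Submodule.starProjection_apply_mem _ _
  have hp₀ : x - x₀ ∈ θ.fixedᗮ := Submodule.sub_starProjection_mem_orthogonal x
  have hp₁ : x - x₁ ∈ E₁ᗮ := Submodule.sub_starProjection_mem_orthogonal x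
  have hp₂ : x - x₂ ∈ E₂ᗮ := Submodule.sub_starProjection_mem_orthogonal x
  have hsum : x = x₀ + x₁ + x₂ := by
    have hz : x - x₀ - x₁ - x₂ ∈ (θ.fixed ⊔ E₁ ⊔ E₂)ᗮ := by
      rw [← Submodule.inf_orthogonal, ← Submodule.inf_orthogonal]
      refine ⟨⟨?_, ?_⟩, ?_⟩
      · exact sub_mem (sub_mem hp₀ (h01.symm hm₁)) (h02.symm hm₂)
      · rw [sub_right_comm x]
        exact sub_mem (sub_mem hp₁ (h01 hm₀)) (h12.symm hm₂)
      · rw [sub_right_comm _ x₁, sub_right_comm x]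
        exact sub_mem (sub_mem hp₂ (h02 hm₀)) (h12 hm₁)
    rw [hdense, Submodule.mem_bot] at hz
    rw [← sub_eq_zero, ← hz]
    abel
  have hnorm : ‖x₁‖ ^ 2 + ‖x₂‖ ^ 2 ≤ ‖x‖ ^ 2 := by
    have i01 := Submodule.isOrtho_iff_inner_eq.1 h01 _ hm₀ _ hm₁
    have i02 := Submodule.isOrtho_iff_inner_eq.1 h02 _ hm₀ _ hm₂
    have i12 := Submodule.isOrtho_iff_inner_eq.1 h12 _ hm₁ _ hm₂
    have e1 := norm_add_sq_eq_norm_sq_add_norm_sq_of_inner_eq_zero (𝕜 := ℂ) x₀ x₁ i01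
    have e2 := norm_add_sq_eq_norm_sq_add_norm_sq_of_inner_eq_zero (𝕜 := ℂ) (x₀ + x₁) x₂
      (by rw [inner_add_left, i02, i12, add_zero])
    rw [hsum]
    nlinarith [mul_self_nonneg ‖x₀‖]
  -- Only the `E₁` component determines `k₀`, which is therefore chosen before `k`.
  obtain ⟨k₀, hk₀, hpos⟩ := θ.exists_mem_support_re_inner_avg_nonneg μ x₁
  refine ⟨k₀, hk₀, fun k => ?_⟩
  set s := UnitaryDual.seminormOn (UnitaryDual.large.{u, w} μ δ) k with hs
  have hs0 : 0 ≤ s := UnitaryDual.seminormOn_nonneg _ k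
  have hcl₀ := θ.isClosed_fixed
  have hinv₀ := θ.invariant_fixed
  have hexp : inner ℂ (θ.avg μ x) (θ (k₀ * k) x) = inner ℂ x₀ x₀
      + inner ℂ (θ.avg μ x₁) (θ (k₀ * k) x₁) + inner ℂ (θ.avg μ x₂) (θ (k₀ * k) x₂) := by
    conv_lhs => rw [hsum]
    have hfix₀ := hm₀ (k₀ * k)
    have i01 := θ.inner_avg_apply_eq_zero μ hinv₀ hinv₁ hcl₀ h01 hm₀ hm₁ (k₀ * k)
    have i02 := θ.inner_avg_apply_eq_zero μ hinv₀ hinv₂ hcl₀ h02 hm₀ hm₂ (k₀ * k)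
    have i10 := θ.inner_avg_apply_eq_zero μ hinv₁ hinv₀ hcl₁ h01.symm hm₁ hm₀ (k₀ * k)
    have i20 := θ.inner_avg_apply_eq_zero μ hinv₂ hinv₀ hcl₂ h02.symm hm₂ hm₀ (k₀ * k)
    rw [hfix₀] at i10 i20
    rw [θ.avg_eq_self μ hm₀] at i01 i02
    simp only [map_add, inner_add_left, inner_add_right, i01, i02, i10, i20,
      θ.inner_avg_apply_eq_zero μ hinv₁ hinv₂ hcl₁ h12 hm₁ hm₂,
      θ.inner_avg_apply_eq_zero μ hinv₂ hinv₁ hcl₂ h12.symm hm₂ hm₁,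
      θ.avg_eq_self μ hm₀, hfix₀]
    ring
  have hfix : (inner ℂ x₀ x₀).re = ‖x₀‖ ^ 2 := inner_self_eq_norm_sq (𝕜 := ℂ) x₀
  have hone : -(s * ‖x₁‖ ^ 2) ≤ (inner ℂ (θ.avg μ x₁) (θ (k₀ * k) x₁)).re := by
    have hdec : θ (k₀ * k) x₁ = θ k₀ x₁ + θ k₀ (θ k x₁ - x₁) := by
      rw [map_sub, add_sub_cancel, mul_apply]
    rw [hdec, inner_add_right, Complex.add_re]
    have hle : ‖inner ℂ (θ.avg μ x₁) (θ k₀ (θ k x₁ - x₁))‖ ≤ ‖x₁‖ * (s * ‖x₁‖) := by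
      refine (norm_inner_le_norm _ _).trans (mul_le_mul ?_ ?_ (norm_nonneg _) (norm_nonneg _))
      · exact θ.norm_avg_apply_le μ x₁
      · rw [LinearIsometryEquiv.norm_map]
        exact hb₁ k x₁ hm₁
    have hre := (abs_le.1 ((Complex.abs_re_le_norm _).trans hle)).1
    nlinarith
  have htwo : -(δ * ‖x₂‖ ^ 2) ≤ (inner ℂ (θ.avg μ x₂) (θ (k₀ * k) x₂)).re := by
    have hle : ‖inner ℂ (θ.avg μ x₂) (θ (k₀ * k) x₂)‖ ≤ (δ * ‖x₂‖) * ‖x₂‖ := by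
      refine (norm_inner_le_norm _ _).trans ?_
      rw [LinearIsometryEquiv.norm_map]
      exact mul_le_mul_of_nonneg_right (hb₂ x₂ hm₂) (norm_nonneg _)
    have hre := (abs_le.1 ((Complex.abs_re_le_norm _).trans hle)).1
    nlinarith
  rw [hexp, Complex.add_re, Complex.add_re, hfix]
  nlinarith [sq_nonneg ‖x₁‖, sq_nonneg ‖x₂‖,
    mul_nonneg hs0 (sub_nonneg.2 hnorm), mul_nonneg hδ (sub_nonneg.2 hnorm),
    mul_nonneg hs0 (sq_nonneg ‖x₂‖), mul_nonneg hδ (sq_nonneg ‖x₁‖)]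

end Decomposition

end UnitaryRep

theorem exists_norm_eq_one_inner_eq_norm {V : Type*} [NormedAddCommGroup V]
    [InnerProductSpace ℂ V] [Nontrivial V] (a : V) :
    ∃ b : V, ‖b‖ = 1 ∧ inner ℂ b a = (‖a‖ : ℂ) := by
  rcases eq_or_ne a 0 with rfl | ha
  · obtain ⟨b, hb⟩ := exists_norm_eq V zero_le_one
    exact ⟨b, hb, by simp⟩
  · have ha' : (‖a‖ : ℂ) ≠ 0 := by exact_mod_cast norm_ne_zero_iff.2 ha
    refine ⟨(‖a‖ : ℂ)⁻¹ • a, norm_smul_inv_norm ha, ?_⟩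
    rw [inner_smul_left, inner_self_eq_norm_sq_to_K, map_inv₀, Complex.conj_ofReal]
    simp only [Complex.coe_algebraMap]
    field_simp

theorem exists_norm_eq_one_lt_norm_apply {V W : Type*} [NormedAddCommGroup V]
    [NormedSpace ℂ V] [NormedAddCommGroup W] [NormedSpace ℂ W] (T : V →L[ℂ] W) {r : ℝ}
    (hr : 0 ≤ r) (h : r < ‖T‖) : ∃ x, ‖x‖ = 1 ∧ r < ‖T x‖ := by
  by_contra! hcon
  refine h.not_ge (T.opNorm_le_bound hr fun x => ?_)
  rcases eq_or_ne x 0 with rfl | hx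
  · simp
  have h1 := hcon ((‖x‖ : ℂ)⁻¹ • x) (norm_smul_inv_norm hx)
  rw [map_smul, norm_smul, norm_inv, Complex.norm_real, norm_norm,
    inv_mul_le_iff₀ (norm_pos_iff.2 hx)] at h1
  rwa [mul_comm]

/-! ### Bessel's inequality and the size of `S_δ` -/

section Bessel

variable {K : Type u} [Group K] [TopologicalSpace K] [IsTopologicalGroup K] [CompactSpace K]
variable [MeasurableSpace K] [BorelSpace K]

open UnitaryRep in
/-- Bessel's inequality for matrix coefficients of pairwise inequivalent irreducible
representations against the density of `μ`. -/
theorem sum_finrank_mul_norm_avg_sq_le {μ : Measure K} [IsProbabilityMeasure μ]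
    (hμ : μ ≪ haarProb K) {ξ : ℝ}
    (hξ : eLpNorm (μ.rnDeriv (haarProb K)) 2 (haarProb K) ≤ ENNReal.ofReal ξ) {ι : Type*}
    (s : Finset ι) (σ : ι → UnitaryIrrep.{u, w} K)
    (hσ : ∀ i j, i ≠ j → ¬ (σ i).rep.Equivalent (σ j).rep) (x : ∀ i, (σ i).space)
    (hx : ∀ i, ‖x i‖ = 1) :
    ∑ i ∈ s, (Module.finrank ℂ (σ i).space : ℝ) * ‖(σ i).rep.avg μ (x i)‖ ^ 2 ≤ ξ ^ 2 := by
  have hfin : ∀ i, FiniteDimensional ℂ (σ i).space := fun i => (σ i).irreducible.finiteDimensional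
  have hnt : ∀ i, Nontrivial (σ i).space := fun i => (σ i).irreducible.1
  choose b hb hba using fun i => exists_norm_eq_one_inner_eq_norm ((σ i).rep.avg μ (x i))
  set m := haarProb K with hm
  let d : ι → ℝ := fun i => Module.finrank ℂ (σ i).space
  have hd : ∀ i, ((√(d i) : ℝ) : ℂ) * ((√(d i) : ℝ) : ℂ) = (d i : ℂ) := fun i => by
    rw [← Complex.ofReal_mul, Real.mul_self_sqrt (Nat.cast_nonneg _)]
  -- The factor `√d` normalises by Schur orthogonality. The coefficient is conjugated so that the
  -- inner product with `f`, conjugate-linear in `φ`, gives `⟪b, σ(μ)x⟫`.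
  let φ : ι → K → ℂ := fun i k => (√(d i) : ℂ) * inner ℂ ((σ i).rep k (x i)) (b i)
  have hφc : ∀ i, Continuous (φ i) := fun i =>
    continuous_const.mul (((σ i).rep.strongly_continuous (x i)).inner continuous_const)
  have hφ : ∀ i, MemLp (φ i) 2 m := fun i =>
    (hφc i).memLp_of_hasCompactSupport (HasCompactSupport.of_compactSpace _)
  let f : K → ℂ := fun k => ((μ.rnDeriv m k).toReal : ℂ)
  have hfm : Measurable f :=
    Complex.measurable_ofReal.comp (Measure.measurable_rnDeriv _ _).ennreal_toReal
  have hfle : eLpNorm f 2 m ≤ ENNReal.ofReal ξ := by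
    refine le_trans (eLpNorm_mono_enorm fun k => ?_) hξ
    simp only [f, enorm_eq_self]
    rw [← ofReal_norm, Complex.norm_real, Real.norm_eq_abs,
      abs_of_nonneg ENNReal.toReal_nonneg]
    exact ENNReal.ofReal_toReal_le
  have hf : MemLp f 2 m := ⟨hfm.aestronglyMeasurable, hfle.trans_lt ENNReal.ofReal_lt_top⟩
  have hnorm : ‖hf.toLp f‖ ^ 2 ≤ ξ ^ 2 := by
    -- Comparing with `|ξ|` avoids a sign assumption on `ξ`.
    rw [sq_le_sq, abs_norm, Lp.norm_toLp]
    refine ENNReal.toReal_le_of_le_ofReal (abs_nonneg _)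
      (hfle.trans (ENNReal.ofReal_le_ofReal (le_abs_self ξ)))
  have hinner : ∀ i j, inner ℂ ((hφ i).toLp (φ i)) ((hφ j).toLp (φ j))
      = (√(d i) : ℂ) * (√(d j) : ℂ) * ∫ k, inner ℂ ((σ j).rep k (x j)) (b j) *
          inner ℂ (b i) ((σ i).rep k (x i)) ∂m := by
    intro i j
    rw [L2.inner_def, ← integral_const_mul]
    refine integral_congr_ae ?_
    filter_upwards [(hφ i).coeFn_toLp, (hφ j).coeFn_toLp] with k h1 h2
    rw [h1, h2, RCLike.inner_apply]
    simp only [φ, map_mul, Complex.conj_ofReal, inner_conj_symm]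
    ring
  have horth : Orthonormal ℂ fun i => (hφ i).toLp (φ i) := by
    classical
    rw [orthonormal_iff_ite]
    intro i j
    rw [hinner]
    split_ifs with hij
    · subst hij
      have h := (σ i).irreducible.integral_norm_inner_sq (b i) (x i)
      have h3 : ∀ k, inner ℂ ((σ i).rep k (x i)) (b i) * inner ℂ (b i) ((σ i).rep k (x i))
          = ((‖inner ℂ (b i) ((σ i).rep k (x i))‖ ^ 2 : ℝ) : ℂ) := fun k => by
        rw [← inner_conj_symm ((σ i).rep k (x i)) (b i), ← Complex.normSq_eq_norm_sq,
          Complex.normSq_eq_conj_mul_self]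
      simp only [h3]
      rw [hd, integral_complex_ofReal, ← Complex.ofReal_mul, h, hb, hx]
      simp
    · rw [(σ i).irreducible.integral_inner_mul_inner_eq_zero (σ j).irreducible
        (hσ j i (Ne.symm hij)), mul_zero]
  have hcoef : ∀ i, ‖inner ℂ ((hφ i).toLp (φ i)) (hf.toLp f)‖ ^ 2
      = (Module.finrank ℂ (σ i).space : ℝ) * ‖(σ i).rep.avg μ (x i)‖ ^ 2 := by
    intro i
    have h1 : inner ℂ ((hφ i).toLp (φ i)) (hf.toLp f)
        = (√(d i) : ℂ) * (‖(σ i).rep.avg μ (x i)‖ : ℂ) := by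
      rw [← hba, inner_avg_left, ← integral_rnDeriv_smul hμ, L2.inner_def, ← integral_const_mul]
      refine integral_congr_ae ?_
      filter_upwards [(hφ i).coeFn_toLp, hf.coeFn_toLp] with k h1 h2
      rw [h1, h2, RCLike.inner_apply]
      simp only [φ, f, map_mul, Complex.conj_ofReal, inner_conj_symm, Complex.real_smul]
      ring
    rw [h1, norm_mul, Complex.norm_real, Complex.norm_real, norm_norm, mul_pow, Real.norm_eq_abs,
      sq_abs, Real.sq_sqrt (Nat.cast_nonneg _)]
  have hbessel := horth.sum_inner_products_le (x := hf.toLp f) (s := s)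
  simp only [hcoef] at hbessel
  exact hbessel.trans hnorm

namespace UnitaryDual

theorem dim_mk (σ : UnitaryIrrep.{u, w} K) :
    dim (⟦σ⟧ : UnitaryDual.{u, w} K) = Module.finrank ℂ σ.space := by
  have := σ.irreducible.finiteDimensional
  change Cardinal.toENat (Module.rank ℂ σ.space) = _
  rw [← Module.finrank_eq_rank, Cardinal.toENat_nat]

/-- The cardinality bound for finite subsets of `S_δ`. -/
theorem card_mul_le {μ : Measure K} [IsProbabilityMeasure μ] (hμ : μ ≪ haarProb K) {ξ : ℝ}
    (hξ : eLpNorm (μ.rnDeriv (haarProb K)) 2 (haarProb K) ≤ ENNReal.ofReal ξ) {δ : ℝ}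
    (hδ : 0 ≤ δ) {n : ℕ} (hn : (n : ℕ∞) ≤ minDim.{u, w} K) (F : Finset (UnitaryDual.{u, w} K))
    (hF : ∀ c ∈ F, c ∈ large.{u, w} μ δ) : (F.card : ℝ) * (n * δ ^ 2) ≤ ξ ^ 2 - 1 := by
  classical
  let σ : UnitaryDual.{u, w} K → UnitaryIrrep.{u, w} K := fun c => Quotient.out c
  have hmk : ∀ c, (⟦σ c⟧ : UnitaryDual.{u, w} K) = c := fun c => Quotient.out_eq c
  have hex : ∀ c, ∃ x : (σ c).space, ‖x‖ = 1 ∧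
      (c ∈ large.{u, w} μ δ → δ < ‖(σ c).rep.avg μ x‖) := by
    intro c
    have := (σ c).irreducible.1
    by_cases hc : c ∈ large.{u, w} μ δ
    · have h : δ < ‖(σ c).rep.avg μ‖ := by
        have h := hc.2
        rw [← hmk c] at h
        exact h
      obtain ⟨x, hx, hlt⟩ := exists_norm_eq_one_lt_norm_apply _ hδ h
      exact ⟨x, hx, fun _ => hlt⟩
    · obtain ⟨x, hx⟩ := exists_norm_eq (σ c).space zero_le_one
      exact ⟨x, hx, fun h => absurd h hc⟩
  choose x hx hlt using hex
  -- Adjoining the trivial class, which is never in `S_δ`, is the source of the `-1`.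
  have hsum := sum_finrank_mul_norm_avg_sq_le hμ hξ (insert (triv K) F) σ
    (fun c c' hne h => hne (by rw [← hmk c, ← hmk c']; exact Quotient.sound h)) x hx
  rw [Finset.sum_insert fun h => (hF _ h).1 rfl] at hsum
  have htriv : (1 : ℝ) ≤ (Module.finrank ℂ (σ (triv K)).space : ℝ) *
      ‖(σ (triv K)).rep.avg μ (x (triv K))‖ ^ 2 := by
    have hfin := (σ (triv K)).irreducible.finiteDimensional
    have := (σ (triv K)).irreducible.1
    have he : (σ (triv K)).rep.Equivalent (UnitaryIrrep.trivial.{u, w} K).rep :=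
      Quotient.exact (hmk (triv K))
    rw [UnitaryRep.avg_eq_self _ _ fun k => he.apply_eq_of_trivial k _, hx, one_pow, mul_one]
    exact_mod_cast Module.finrank_pos (R := ℂ) (M := (σ (triv K)).space)
  have hrest : (F.card : ℝ) * (n * δ ^ 2) ≤
      ∑ c ∈ F, (Module.finrank ℂ (σ c).space : ℝ) * ‖(σ c).rep.avg μ (x c)‖ ^ 2 := by
    rw [← nsmul_eq_mul]
    refine Finset.card_nsmul_le_sum _ _ _ fun c hc => ?_
    have hdim : (n : ℕ∞) ≤ Module.finrank ℂ (σ c).space := by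
      rw [← dim_mk, hmk]
      exact hn.trans (iInf_le (fun c : {c : UnitaryDual.{u, w} K // c ≠ triv K} => c.1.dim)
        ⟨c, (hF c hc).1⟩)
    exact mul_le_mul (by exact_mod_cast hdim)
      (pow_le_pow_left₀ hδ (hlt c (hF c hc)).le 2) (by positivity) (by positivity)
  linarith

theorem one_le_minDim : 1 ≤ minDim.{u, w} K := by
  refine le_iInf fun c => ?_
  obtain ⟨c, hc⟩ := c
  induction c using Quotient.inductionOn with
  | h σ =>
    have := σ.irreducible.1
    have := σ.irreducible.finiteDimensional
    rw [dim_mk]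
    exact_mod_cast Module.finrank_pos (R := ℂ) (M := σ.space)

/-- A uniform bound on finite subsets of `S_δ` forces finiteness and then the estimate. If `d_K = ∞`
then `S_δ` is empty, because every irreducible is finite-dimensional. -/
theorem encard_large_le {μ : Measure K} [IsProbabilityMeasure μ] (hμ : μ ≪ haarProb K) {ξ : ℝ}
    (hξ : eLpNorm (μ.rnDeriv (haarProb K)) 2 (haarProb K) ≤ ENNReal.ofReal ξ) {δ : ℝ}
    (hδ : 0 < δ) :
    ((large.{u, w} μ δ).encard : ENNReal)
      ≤ ENNReal.ofReal (ξ ^ 2 - 1) / ((minDim.{u, w} K : ENNReal) * ENNReal.ofReal (δ ^ 2)) := by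
  rcases (large.{u, w} μ δ).eq_empty_or_nonempty with hemp | ⟨c₀, hc₀⟩
  · simp [hemp]
  have htop : minDim.{u, w} K ≠ ⊤ := by
    have hle : minDim.{u, w} K ≤ c₀.dim :=
      iInf_le (fun c : {c : UnitaryDual.{u, w} K // c ≠ triv K} => c.1.dim) ⟨c₀, hc₀.1⟩
    refine ne_top_of_le_ne_top ?_ hle
    rw [← Quotient.out_eq c₀, dim_mk]
    exact ENat.natCast_ne_top _
  obtain ⟨n, hn⟩ := ENat.ne_top_iff_exists.1 htop
  have hn1 : 1 ≤ n := by
    have h : 1 ≤ minDim.{u, w} K := one_le_minDim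
    rw [← hn] at h
    exact_mod_cast h
  have hpos : 0 < (n : ℝ) * δ ^ 2 := mul_pos (by exact_mod_cast hn1) (by positivity)
  have hcard := fun F hF => card_mul_le hμ hξ hδ.le hn.le F hF
  have hfinite : (large.{u, w} μ δ).Finite := by
    by_contra hinf
    obtain ⟨N, hN⟩ := exists_nat_gt ((ξ ^ 2 - 1) / (n * δ ^ 2))
    obtain ⟨F, hF, hFN⟩ := Set.Infinite.exists_subset_card_eq hinf N
    have h := hcard F fun c hc => hF hc
    rw [← le_div_iff₀ hpos, hFN] at h
    exact hN.not_ge h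
  have h := hcard hfinite.toFinset fun c hc => hfinite.mem_toFinset.1 hc
  have hden : (minDim.{u, w} K : ENNReal) * ENNReal.ofReal (δ ^ 2)
      = ENNReal.ofReal (n * δ ^ 2) := by
    rw [← hn, ENNReal.ofReal_mul (Nat.cast_nonneg _), ENNReal.ofReal_natCast,
      ENat.toENNReal_coe]
  rw [hden, ENNReal.le_div_iff_mul_le (Or.inl (ENNReal.ofReal_pos.2 hpos).ne')
    (Or.inl ENNReal.ofReal_ne_top), hfinite.encard_eq_coe_toFinset_card, ENat.toENNReal_coe,
    ← ENNReal.ofReal_natCast, ← ENNReal.ofReal_mul (Nat.cast_nonneg _)]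
  exact ENNReal.ofReal_le_ofReal h

end UnitaryDual

end Bessel

end

theorem proposition3p2 {K : Type u} [Group K] [TopologicalSpace K] [IsTopologicalGroup K]
    [CompactSpace K] [T2Space K] [MeasurableSpace K] [BorelSpace K]
    (μ : Measure K) [IsProbabilityMeasure μ] [μ.Regular]
    {V : Type v} [NormedAddCommGroup V] [InnerProductSpace ℂ V] [CompleteSpace V]
    (θ : UnitaryRep K V) (δ : ℝ) (hδ : 0 < δ) :
    (∀ x : V, ∃ k₀ ∈ μ.support, ∀ k : K,
      ‖θ.fixedProj x‖ ^ 2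
          - (2 * δ + UnitaryDual.seminormOn (UnitaryDual.large.{u, w} μ δ) k) * ‖x‖ ^ 2
        ≤ (inner ℂ (θ.avg μ x) (θ (k₀ * k) x)).re) ∧
    (∀ ξ : ℝ, μ ≪ haarProb K →
      eLpNorm (μ.rnDeriv (haarProb K)) 2 (haarProb K) ≤ ENNReal.ofReal ξ →
      ((UnitaryDual.large.{u, w} μ δ).encard : ENNReal)
        ≤ ENNReal.ofReal (ξ ^ 2 - 1)
          / ((UnitaryDual.minDim.{u, w} K : ENNReal) * ENNReal.ofReal (δ ^ 2))) := by
  refine ⟨fun x => ?_, fun ξ hμ hξ => UnitaryDual.encard_large_le hμ hξ hδ⟩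
  obtain ⟨k₀, hk₀, h⟩ := θ.exists_mem_support_re_inner_avg_ge.{u, v, w} μ hδ.le x
  refine ⟨k₀, hk₀, fun k => le_trans ?_ (h k)⟩
  nlinarith [mul_nonneg hδ.le (sq_nonneg ‖x‖)]
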